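/- For $x \in \mathbb{R}$ let $\|x\|$ denote the distance from $x$ to the nearest integer and $\{x\}$ the fractional part of $x$. Let $I \subseteq [0,1)$ be a set with non-empty interior, let $a, c > 0$ with $a \neq 1$, and let $\gamma \in \mathbb{R} \setminus \{0\}$. Then for Lebesgue-almost every $\alpha > 1$, the system $$\|a^{1/\alpha} n\| \leq \frac{c}{n^{\alpha-1}}, \qquad \{\gamma n^{\alpha}\} \in I$$ has infinitely many solutions in positive integers $n$ if $\alpha < 2$, and only finitely many solutions in positive integers $n$ if $\alpha > 2$. -/

import Mathlib

/-- The distance from a real number to the nearest integer. -/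
noncomputable def distNearestInt (x : ℝ) : ℝ := |x - round x|

/-- The positive integers `n` with `‖a ^ (1 / α) n‖ ≤ c / n ^ (α - 1)` and `{γ n ^ α} ∈ I`,
where `‖·‖` is the distance to the nearest integer and `{·}` the fractional part. -/
def twistedSolutions (I : Set ℝ) (a c γ α : ℝ) : Set ℕ :=
  {n : ℕ | 0 < n ∧
    distNearestInt (a ^ (1 / α) * (n : ℝ)) ≤ c / (n : ℝ) ^ (α - 1) ∧
    Int.fract (γ * (n : ℝ) ^ α) ∈ I}

/-!
For `α > 2`, infinitely many solutions would make `a ^ (1 / α)` rational or Liouville with exponent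
`α > 2`. Both kinds of numbers form a null set, and the differentiable map `θ ↦ log a / log θ`, which
inverts `α ↦ a ^ (1 / α)`, carries null sets to null sets.

For `1 < α < 2` the divergence half needs no exponential sums. Fix `k` and let `S` be the set of
`α ∈ (1, 2)` for which no `n ≥ k` is a solution. By Dirichlet's theorem every `x ∈ S` admits
infinitely many `n` with `‖a ^ (1 / x) n‖ ≤ 1 / n`, and `1 / n = o(n ^ (1 - x))`. For such an `n` put
`r = 2 / (|γ| n ^ x log n)`. Moving the exponent from `x` to `α ∈ [x, x + r]` changes `a ^ (1 / α) n`
by only `O(n ^ (1 - x) / log n)`, so the first condition survives; meanwhile `γ n ^ α` runs over a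
range of length at least `2`, and hence `{γ n ^ α}` lies in a given interval inside `I` for all `α` in
an interval of length at least a fixed multiple of `r` (`exists_Ioo_mul_rpow_mem`). So `S` has, at
each of its points, holes of proportional size at arbitrarily small scales, and the Lebesgue density
theorem shows that it is null (`volume_eq_zero_of_porous`).
-/

open Filter Topology MeasureTheory Set

/-! ### Porous sets -/

/-- A set of reals is null if, around each of its points `x`, arbitrarily small balls contain an
interval that misses the set and occupies a fixed proportion of the ball: such an `x` is not a
Lebesgue density point. -/
theorem volume_eq_zero_of_porous {S : Set ℝ}
    (h : ∀ x ∈ S, ∃ δ > 0, ∃ᶠ r in 𝓝[>] (0 : ℝ), ∃ p q, δ * r ≤ q - p ∧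
      Ioo p q ⊆ Metric.closedBall x r \ S) : volume S = 0 := by
  have hd := Besicovitch.ae_tendsto_measure_inter_div (volume : Measure ℝ) S
  rw [ae_iff] at hd
  refine measure_mono_null ?_ (le_antisymm ((Measure.le_restrict_apply _ _).trans hd.le) zero_le)
  intro x hx
  refine ⟨fun ht => ?_, hx⟩
  obtain ⟨δ, hδ, hf⟩ := h x hx
  have hlt : ENNReal.ofReal (1 - δ / 2) < 1 := by
    rw [ENNReal.ofReal_lt_one]; linarith
  obtain ⟨r, ⟨p, q, hpq, hsub⟩, hr, hr0⟩ :=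
    (hf.and_eventually ((ht.eventually (lt_mem_nhds hlt)).and self_mem_nhdsWithin)).exists
  replace hr0 : 0 < r := hr0
  refine absurd hr (not_lt.mpr ?_)
  have hball : volume (Metric.closedBall x r) = ENNReal.ofReal (2 * r) := Real.volume_closedBall x r
  have hle : volume (S ∩ Metric.closedBall x r) ≤ ENNReal.ofReal (2 * r - δ * r) := by
    calc volume (S ∩ Metric.closedBall x r)
        ≤ volume (Metric.closedBall x r \ Ioo p q) :=
          measure_mono fun y hy => ⟨hy.2, fun hy' => (hsub hy').2 hy.1⟩
      _ = volume (Metric.closedBall x r) - volume (Ioo p q) :=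
          measure_sdiff (fun y hy => (hsub hy).1) measurableSet_Ioo.nullMeasurableSet
            (by simp)
      _ = ENNReal.ofReal (2 * r - (q - p)) := by
          rw [hball, Real.volume_Ioo, ENNReal.ofReal_sub _ ((mul_pos hδ hr0).le.trans hpq)]
      _ ≤ _ := ENNReal.ofReal_le_ofReal (by linarith)
  rw [hball]
  refine (ENNReal.div_le_div_right hle _).trans ?_
  rw [← ENNReal.ofReal_div_of_pos (by linarith)]
  refine ENNReal.ofReal_le_ofReal (le_of_eq ?_)
  field_simp

/-! ### Distance to the nearest integer -/

theorem distNearestInt_le (x : ℝ) (m : ℤ) : distNearestInt x ≤ |x - m| := round_le x m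

/-- Dirichlet's theorem, for rational `θ` as well: there `q θ = m` holds for some `q > 0`, and the
multiples of `q` serve. -/
theorem frequently_distNearestInt_le (θ : ℝ) :
    ∃ᶠ n : ℕ in atTop, distNearestInt (θ * n) ≤ 1 / n := by
  rw [frequently_atTop]
  intro N
  by_cases hq : ∃ q : ℕ, 0 < q ∧ distNearestInt (θ * q) = 0
  · obtain ⟨q, hq, h0⟩ := hq
    refine ⟨N * q, Nat.le_mul_of_pos_right N hq, ?_⟩
    have h1 : θ * q = round (θ * q) := by
      simpa [distNearestInt, sub_eq_zero] using h0
    have h2 := distNearestInt_le (θ * (N * q : ℕ)) (N * round (θ * q))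
    have h3 : θ * (N * q : ℕ) - ((N * round (θ * q) : ℤ) : ℝ) = 0 := by
      push_cast
      rw [← h1]; ring
    rw [h3, abs_zero] at h2
    exact h2.trans (by positivity)
  · push Not at hq
    have hpos : ∀ n : ℕ, 0 < n → 0 < distNearestInt (θ * n) := fun n hn =>
      lt_of_le_of_ne (abs_nonneg _) (hq n hn).symm
    have hev : ∀ᶠ M : ℕ in atTop,
        ∀ n ∈ Finset.Icc 1 N, 1 / ((M : ℝ) + 1) < distNearestInt (θ * n) := by
      rw [Filter.eventually_all_finset]
      intro n hn
      exact tendsto_one_div_add_atTop_nhds_zero_nat.eventually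
        (gt_mem_nhds (hpos n (Finset.mem_Icc.mp hn).1))
    obtain ⟨M, hM, hM0⟩ := (hev.and (eventually_gt_atTop 0)).exists
    obtain ⟨n, hn0, hnM, hn⟩ := Real.exists_nat_abs_mul_sub_round_le θ hM0
    have hn' : distNearestInt (θ * n) ≤ 1 / ((M : ℝ) + 1) := by
      rw [mul_comm]; exact hn
    refine ⟨n, ?_, hn'.trans ?_⟩
    · by_contra hlt
      exact absurd hn' (not_le.mpr (hM n (Finset.mem_Icc.mpr ⟨hn0, by omega⟩)))
    · have : (n : ℝ) ≤ M := by exact_mod_cast hnM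
      have : (0 : ℝ) < n := by exact_mod_cast hn0
      gcongr
      linarith

/-! ### Varying the exponent -/

/-- Write `T = b N ^ x`. As `α` runs over an interval of length `2 / (T log N)` to the right of `x`,
`b N ^ α` passes through a translate of `(u, v)` by an integer, and spends there a proportion of at
least `(v - u) / 4`. -/
theorem exists_Ioo_mul_rpow_mem {b N x u v : ℝ} (hb : 0 < b) (hN : 1 < N) (huv : u < v)
    (hvu : v ≤ u + 1) (hT : 2 ≤ b * N ^ x) :
    ∃ (k : ℤ) (p q : ℝ), x ≤ p ∧ q ≤ x + 2 / (b * N ^ x * Real.log N) ∧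
      (v - u) / 4 * (2 / (b * N ^ x * Real.log N)) ≤ q - p ∧
      ∀ α ∈ Ioo p q, b * N ^ α - k ∈ Ioo u v ∧ N ^ α ≤ 2 * N ^ x := by
  set T := b * N ^ x with hTdef
  have hT0 : 0 < T := by linarith
  have hN0 : 0 < N := by linarith
  have hlog : 0 < Real.log N := Real.log_pos hN
  set κ : ℤ := ⌈T - u⌉
  have h1 : T ≤ κ + u := by linarith [Int.le_ceil (T - u)]
  have h2 : κ + v ≤ T + 2 := by linarith [Int.ceil_lt_add_one (T - u)]
  have hu0 : 0 < κ + u := by linarith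
  have hv0 : 0 < κ + v := by linarith
  have hx : x = Real.logb N (T / b) := by
    rw [hTdef, mul_div_cancel_left₀ _ hb.ne', Real.logb_rpow hN0 hN.ne']
  clear_value T
  refine ⟨κ, Real.logb N ((κ + u) / b), Real.logb N ((κ + v) / b), ?_, ?_, ?_, ?_⟩
  · rw [hx]
    exact Real.logb_le_logb_of_le hN (by positivity) (by gcongr)
  · rw [← sub_le_iff_le_add']
    nth_rw 1 [hx]
    rw [← Real.logb_div (by positivity) (by positivity), div_div_div_cancel_right₀ hb.ne',
      Real.logb, ← div_div]
    gcongr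
    refine (Real.log_le_sub_one_of_pos (by positivity)).trans ?_
    rw [div_sub_one hT0.ne']
    gcongr
    linarith
  · rw [← Real.logb_div (by positivity) (by positivity), div_div_div_cancel_right₀ hb.ne',
      Real.logb]
    have h3 : (v - u) / 4 * (2 / (T * Real.log N)) = (v - u) / (2 * T) / Real.log N := by
      field_simp; norm_num
    rw [h3]
    gcongr
    refine le_trans ?_ (Real.one_sub_inv_le_log_of_pos (by positivity))
    have h4 : 1 - ((κ + v) / (κ + u))⁻¹ = (v - u) / (κ + v) := by
      field_simp; ring
    rw [h4]
    have : 0 ≤ v - u := by linarith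
    gcongr
    linarith
  · rintro α ⟨hα1, hα2⟩
    rw [Real.logb_lt_iff_lt_rpow hN (by positivity), div_lt_iff₀' hb] at hα1
    rw [Real.lt_logb_iff_rpow_lt hN (by positivity), lt_div_iff₀' hb] at hα2
    refine ⟨⟨by linarith, by linarith⟩, ?_⟩
    refine le_of_mul_le_mul_left ?_ hb
    linarith

theorem differentiableAt_rpow_one_div {a x : ℝ} (ha : 0 < a) (hx : x ≠ 0) :
    DifferentiableAt ℝ (fun α : ℝ => a ^ (1 / α)) x := by
  fun_prop (disch := first | exact hx | exact ha.ne')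

/-- The second condition for either sign of `γ`: for `γ < 0` the interval `(u, v)` is reflected. -/
theorem exists_Ioo_fract_mem {γ N x u v : ℝ} (hγ : γ ≠ 0) (hN : 1 < N) (huv : u < v)
    (hu : 0 ≤ u) (hv : v ≤ 1) (hT : 2 ≤ |γ| * N ^ x) :
    ∃ p q : ℝ, x ≤ p ∧ q ≤ x + 2 / (|γ| * N ^ x * Real.log N) ∧
      (v - u) / 4 * (2 / (|γ| * N ^ x * Real.log N)) ≤ q - p ∧
      ∀ α ∈ Ioo p q, Int.fract (γ * N ^ α) ∈ Ioo u v ∧ N ^ α ≤ 2 * N ^ x := by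
  have key : ∀ (y : ℝ) (k : ℤ), y - k ∈ Ioo u v → Int.fract y ∈ Ioo u v := by
    intro y k hy
    have : Int.fract y = y - k := by
      rw [Int.fract_eq_iff]
      exact ⟨by linarith [hy.1], by linarith [hy.2], k, by ring⟩
    rwa [this]
  rcases lt_or_gt_of_ne hγ with h | h
  · obtain ⟨k, p, q, h1, h2, h3, h4⟩ := exists_Ioo_mul_rpow_mem (u := -v) (v := -u)
      (abs_pos.mpr hγ) hN (by linarith) (by linarith) hT
    rw [show -u - -v = v - u by ring] at h3
    refine ⟨p, q, h1, h2, h3, fun α hα => ⟨key _ (-k) ?_, (h4 α hα).2⟩⟩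
    obtain ⟨⟨h5, h6⟩, -⟩ := h4 α hα
    rw [abs_of_neg h] at h5 h6
    push_cast
    exact ⟨by linarith, by linarith⟩
  · obtain ⟨k, p, q, h1, h2, h3, h4⟩ := exists_Ioo_mul_rpow_mem
      (abs_pos.mpr hγ) hN huv (by linarith) hT
    refine ⟨p, q, h1, h2, h3, fun α hα => ⟨key _ k ?_, (h4 α hα).2⟩⟩
    rw [← abs_of_pos h]
    exact (h4 α hα).1

/-! ### Exponents below two -/

/-- Around `x ∈ (1, 2)` there are arbitrarily small balls that contain an interval, of proportional
length, of exponents `α` sharing a solution `n ≥ k`. -/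
theorem frequently_exists_Ioo_subset_twistedSolutions {I : Set ℝ} {a c γ x u v : ℝ}
    (ha : 0 < a) (hc : 0 < c) (hγ : γ ≠ 0) (huv : u < v) (hu : 0 ≤ u) (hv : v ≤ 1)
    (hI : Ioo u v ⊆ I) (hx1 : 1 < x) (hx2 : x < 2) (k : ℕ) :
    ∃ᶠ r in 𝓝[>] (0 : ℝ), ∃ p q, (v - u) / 4 * r ≤ q - p ∧
      Ioo p q ⊆ Metric.closedBall x r ∩ {α | ∃ n ≥ k, n ∈ twistedSolutions I a c γ α} := by
  have hγ0 : 0 < |γ| := abs_pos.mpr hγ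
  obtain ⟨L, hL⟩ := (differentiableAt_rpow_one_div ha (by linarith : x ≠ 0)).isBigO_sub.bound
  obtain ⟨η, hη, hL⟩ := Metric.eventually_nhds_iff.mp hL
  have hcast := tendsto_natCast_atTop_atTop (R := ℝ)
  have hlog := Real.tendsto_log_atTop.comp hcast
  have hpow : Tendsto (fun n : ℕ => |γ| * (n : ℝ) ^ x) atTop atTop :=
    ((tendsto_rpow_atTop (by linarith : 0 < x)).comp hcast).const_mul_atTop hγ0
  have hr : Tendsto (fun n : ℕ => 2 / (|γ| * (n : ℝ) ^ x * Real.log n)) atTop (𝓝[>] 0) := by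
    refine tendsto_nhdsWithin_iff.mpr ⟨(hpow.atTop_mul_atTop₀ hlog).const_div_atTop 2, ?_⟩
    filter_upwards [eventually_gt_atTop 1] with n hn
    have hn' : (1 : ℝ) < n := by exact_mod_cast hn
    have := Real.log_pos hn'
    rw [mem_Ioi]
    positivity
  -- The two error terms, both divided by `n ^ (1 - x)`: Dirichlet's `1 / n`, and the change of
  -- `a ^ (1 / α) n` over an interval of exponents of length `2 / (|γ| n ^ x log n)`.
  have herr : Tendsto (fun n : ℕ => (n : ℝ) ^ (-(2 - x)) + 2 * |L| / |γ| / Real.log n)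
      atTop (𝓝 0) := by
    have h1 := (tendsto_rpow_neg_atTop (by linarith : 0 < 2 - x)).comp hcast
    simpa using h1.add (hlog.const_div_atTop (2 * |L| / |γ|))
  refine hr.frequently ?_
  refine ((frequently_distNearestInt_le (a ^ (1 / x))).and_eventually
    ((hr.eventually (eventually_nhdsWithin_of_eventually_nhds (gt_mem_nhds hη))).and
    ((herr.eventually (gt_mem_nhds (half_pos hc))).and ((hpow.eventually_ge_atTop 2).and
    ((eventually_ge_atTop k).and (eventually_gt_atTop 1)))))).mono ?_
  rintro n ⟨hn, hrη, hsmall, hT, hk, hn1⟩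
  have hN : (1 : ℝ) < n := by exact_mod_cast hn1
  have hN0 : (0 : ℝ) < n := by linarith
  have hlog0 := Real.log_pos hN
  obtain ⟨p, q, hp, hq, hpq, h⟩ := exists_Ioo_fract_mem hγ hN huv hu hv hT
  refine ⟨p, q, hpq, fun α hα => ?_⟩
  obtain ⟨hα1, hα2⟩ := h α hα
  set r := 2 / (|γ| * (n : ℝ) ^ x * Real.log n) with hrdef
  have hdist : |α - x| ≤ r := by
    rw [abs_of_nonneg (by linarith [hα.1])]
    linarith [hα.2]
  refine ⟨hdist, n, hk, by omega, ?_, hI hα1⟩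
  have hLip : |a ^ (1 / α) - a ^ (1 / x)| ≤ |L| * r := by
    have h1 := hL (y := α) (hdist.trans_lt hrη)
    rw [Real.norm_eq_abs, Real.norm_eq_abs] at h1
    exact h1.trans (mul_le_mul (le_abs_self L) hdist (abs_nonneg _) (abs_nonneg L))
  -- The factor `1 / 2` in `c / 2` pays for `n ^ α ≤ 2 n ^ x` in the last inequality.
  have hmain := calc |a ^ (1 / α) * n - round (a ^ (1 / x) * n)|
    _ = |(a ^ (1 / α) - a ^ (1 / x)) * n + (a ^ (1 / x) * n - round (a ^ (1 / x) * n))| := by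
        ring_nf
    _ ≤ |L| * r * n + 1 / n := by
        refine (abs_add_le _ _).trans (add_le_add ?_ hn)
        rw [abs_mul, abs_of_pos hN0]
        gcongr
    _ = (n / (n : ℝ) ^ x) * ((n : ℝ) ^ (-(2 - x)) + 2 * |L| / |γ| / Real.log n) := by
        rw [neg_sub, Real.rpow_sub hN0, Real.rpow_two, hrdef]
        field_simp
        ring
    _ ≤ (n / (n : ℝ) ^ x) * (c / 2) := by gcongr
    _ = c * n / (2 * (n : ℝ) ^ x) := by field_simp
    _ ≤ c * n / (n : ℝ) ^ α := by gcongr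
    _ = c / (n : ℝ) ^ (α - 1) := by rw [Real.rpow_sub_one hN0.ne', div_div_eq_mul_div]
  exact (distNearestInt_le _ _).trans hmain

theorem volume_setOf_forall_notMem_twistedSolutions {I : Set ℝ} {a c γ : ℝ} (hI : I ⊆ Ico 0 1)
    (hI' : (interior I).Nonempty) (ha : 0 < a) (hc : 0 < c) (hγ : γ ≠ 0) (k : ℕ) :
    volume {α : ℝ | 1 < α ∧ α < 2 ∧ ∀ n ≥ k, n ∉ twistedSolutions I a c γ α} = 0 := by
  obtain ⟨y, hy⟩ := hI'
  obtain ⟨u, v, ⟨h1, h2⟩, huv⟩ :=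
    mem_nhds_iff_exists_Ioo_subset.mp (mem_interior_iff_mem_nhds.mp hy)
  have huv' : u < v := h1.trans h2
  have hcl : Icc u v ⊆ Icc 0 1 := by
    rw [← closure_Ioo huv'.ne]
    exact closure_minimal ((huv.trans hI).trans Ico_subset_Icc_self) isClosed_Icc
  refine volume_eq_zero_of_porous fun x ⟨hx1, hx2, _⟩ => ⟨(v - u) / 4, by linarith, ?_⟩
  refine (frequently_exists_Ioo_subset_twistedSolutions ha hc hγ huv'
    (hcl (left_mem_Icc.mpr huv'.le)).1 (hcl (right_mem_Icc.mpr huv'.le)).2 huv hx1 hx2 k).mono ?_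
  rintro r ⟨p, q, hpq, h⟩
  refine ⟨p, q, hpq, fun α hα => ⟨(h hα).1, fun hS => ?_⟩⟩
  obtain ⟨n, hn, hmem⟩ := (h hα).2
  exact hS.2.2 n hn hmem

theorem ae_infinite_twistedSolutions {I : Set ℝ} {a c γ : ℝ} (hI : I ⊆ Ico 0 1)
    (hI' : (interior I).Nonempty) (ha : 0 < a) (hc : 0 < c) (hγ : γ ≠ 0) :
    ∀ᵐ α : ℝ, 1 < α → α < 2 → (twistedSolutions I a c γ α).Infinite := by
  have h : ∀ᵐ α : ℝ, ∀ k : ℕ, ¬(1 < α ∧ α < 2 ∧ ∀ n ≥ k, n ∉ twistedSolutions I a c γ α) := by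
    rw [ae_all_iff]
    intro k
    rw [ae_iff]
    simpa only [not_not] using volume_setOf_forall_notMem_twistedSolutions hI hI' ha hc hγ k
  filter_upwards [h] with α hα h1 h2
  refine Nat.frequently_atTop_iff_infinite.mp (frequently_atTop.mpr ?_)
  intro k
  have := hα k
  push Not at this
  exact this h1 h2

/-! ### Exponents above two -/

/-- `θ ↦ log a / log θ` is a differentiable left inverse of `α ↦ a ^ (1 / α)`, so the preimage of a
null set under the latter is null. -/
theorem ae_rpow_one_div {a : ℝ} (ha : 0 < a) (ha1 : a ≠ 1) {P : ℝ → Prop} (hP : ∀ᵐ θ : ℝ, P θ) :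
    ∀ᵐ α : ℝ, 0 < α → P (a ^ (1 / α)) := by
  have hla : Real.log a ≠ 0 := Real.log_ne_zero_of_pos_of_ne_one ha ha1
  have hnull : volume ({θ | ¬P θ} ∩ {θ : ℝ | Real.log θ ≠ 0}) = 0 :=
    measure_mono_null inter_subset_left hP
  have hdiff : DifferentiableOn ℝ (fun θ : ℝ => Real.log a / Real.log θ)
      ({θ | ¬P θ} ∩ {θ : ℝ | Real.log θ ≠ 0}) := fun θ hθ => by
    have hθ0 : θ ≠ 0 := fun h => hθ.2 (by simp [h])
    exact ((differentiableAt_const _).div (Real.differentiableAt_log hθ0)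
      hθ.2).differentiableWithinAt
  have himg := addHaar_image_eq_zero_of_differentiableOn_of_addHaar_eq_zero volume hdiff hnull
  rw [ae_iff]
  refine measure_mono_null (fun α hα => ?_) himg
  simp only [mem_ofPred_eq, Classical.not_imp] at hα
  have hlog : Real.log (a ^ (1 / α)) = Real.log a / α := by
    rw [Real.log_rpow ha]; ring
  refine ⟨a ^ (1 / α), ⟨hα.2, ?_⟩, ?_⟩
  · rw [mem_ofPred_eq, hlog]
    exact div_ne_zero hla hα.1.ne'
  · simp only [hlog]
    field_simp

theorem ae_finite_twistedSolutions (I : Set ℝ) {a : ℝ} (c γ : ℝ) (ha : 0 < a) (ha1 : a ≠ 1) :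
    ∀ᵐ α : ℝ, 2 < α → (twistedSolutions I a c γ α).Finite := by
  have hirr : ∀ᵐ θ : ℝ, Irrational θ := (countable_range ((↑) : ℚ → ℝ)).ae_notMem volume
  filter_upwards [ae_rpow_one_div ha ha1 hirr, ae_rpow_one_div ha ha1 ae_not_liouvilleWith]
    with α hα1 hα2 h2
  by_contra hinf
  refine hα2 (by linarith) α h2 ⟨c + 1, ?_⟩
  refine (Nat.frequently_atTop_iff_infinite.mpr hinf).mono ?_
  rintro n ⟨hn, hle, -⟩
  have hN : (0 : ℝ) < n := by exact_mod_cast hn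
  refine ⟨round (a ^ (1 / α) * n), fun h => hα1 (by linarith) ?_, ?_⟩
  · exact ⟨round (a ^ (1 / α) * n) / n, by push_cast; exact h.symm⟩
  · have h3 : a ^ (1 / α) - round (a ^ (1 / α) * n) / n
        = (a ^ (1 / α) * n - round (a ^ (1 / α) * n)) / n := by
      field_simp
    rw [h3, abs_div, abs_of_pos hN, div_lt_div_iff₀ hN (by positivity)]
    rw [distNearestInt, Real.rpow_sub_one hN.ne', div_div_eq_mul_div,
      le_div_iff₀ (by positivity)] at hle
    linarith

theorem theorem2 (I : Set ℝ) (hI : I ⊆ Set.Ico 0 1) (hI' : (interior I).Nonempty)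
    (a c γ : ℝ) (ha : 0 < a) (ha1 : a ≠ 1) (hc : 0 < c) (hγ : γ ≠ 0) :
    ∀ᵐ α : ℝ ∂MeasureTheory.volume, 1 < α →
      (α < 2 → (twistedSolutions I a c γ α).Infinite) ∧
      (2 < α → (twistedSolutions I a c γ α).Finite) := by
  filter_upwards [ae_infinite_twistedSolutions hI hI' ha hc hγ,
    ae_finite_twistedSolutions I c γ ha ha1] with α h1 h2 h
  exact ⟨h1 h, h2⟩
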